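/- All graphs are finite, simple and connected. An embedding of a graph $G$ in an orientable surface is given combinatorially: every edge $\{u,v\}$ is read as two directed edges $e=(u,v)$ and $e^{-1}=(v,u)$, and for every vertex $u$ a cyclic order of all directed edges starting at $u$ is chosen; $\mathrm{nx}(e)$ denotes the successor of $e$ in the order around its starting point. The faces are the directed cyclic walks $e_0,\dots,e_{n-1}$ with $\mathrm{nx}(e_i^{-1})=e_{(i+1) \bmod n}$, that is, the cycles of the permutation $e\mapsto \mathrm{nx}(e^{-1})$ (the one-vertex graph has one, trivial, face). The genus of an embedding with $v$ vertices, $e$ edges and $f$ faces is $\frac{2-(v-e+f)}{2}$, and it is the genus of the surface in which $G$ is embedded. $G$ is planar if it has an embedding of genus $0$. An embedding is polyhedral if every facial walk is a simple cycle and the intersection of any two different faces is either empty, a single vertex or a single edge (with its two ends). The dual of an embedding is the multigraph whose vertices are the faces and in which every edge $e$ of $G$ gives one edge joining the faces containing $e$ and $e^{-1}$; it is simple if it has no loops and no parallel edges. Then: (i) A planar graph has no polyhedral embedding of genus different from $0$. (ii) A cubic planar graph has no embedding of genus different from $0$ whose dual is simple. -/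

import Mathlib

namespace SimpleGraph

universe u

/-- A combinatorial embedding of the graph `G` in an orientable surface (a rotation system).
Every edge `{u, v}` is read as the two darts `(u, v)` and `(v, u)`; for every vertex `u` the
permutation `nx` puts the darts with starting point `u` in one cyclic order. -/
structure OrientedEmbedding {V : Type u} (G : SimpleGraph V) where
  /-- The next dart in the (clockwise) order around the starting point of a dart. -/
  nx : Equiv.Perm G.Dart
  /-- `nx` permutes the darts at each vertex. -/
  fst_nx : ∀ d : G.Dart, (nx d).fst = d.fst
  /-- All darts with the same starting point lie in a single cycle of `nx`. -/
  sameCycle_nx : ∀ d d' : G.Dart, d.fst = d'.fst → nx.SameCycle d d'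

namespace OrientedEmbedding

variable {V : Type u} {G : SimpleGraph V}

/-- The step along a face: the dart `e` is followed by `nx (e⁻¹)`. -/
def faceNext (E : OrientedEmbedding G) : Equiv.Perm G.Dart :=
  (Dart.symm_involutive.toPerm Dart.symm).trans E.nx

/-- The faces (facial walks) of the embedding: the cycles of `faceNext`. -/
def Face (E : OrientedEmbedding G) : Type u :=
  Quotient (Equiv.Perm.SameCycle.setoid E.faceNext)

/-- The face whose facial walk contains the dart `d`. -/
def faceOf (E : OrientedEmbedding G) (d : G.Dart) : E.Face :=
  Quotient.mk (Equiv.Perm.SameCycle.setoid E.faceNext) d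

/-- The darts traversed by the facial walk of `F`; each of them is traversed once. -/
def faceDarts (E : OrientedEmbedding G) (F : E.Face) : Set G.Dart :=
  {d | E.faceOf d = F}

/-- The vertices on the boundary of a face. -/
def faceVerts (E : OrientedEmbedding G) (F : E.Face) : Set V :=
  (fun d : G.Dart => d.fst) '' E.faceDarts F

/-- The undirected edges on the boundary of a face. -/
def faceEdges (E : OrientedEmbedding G) (F : E.Face) : Set (Sym2 V) :=
  (fun d : G.Dart => d.edge) '' E.faceDarts F

/-- The number of faces. An isolated vertex has no darts but still lies in one face, whose
boundary is the trivial walk; among connected graphs this only concerns the one-vertex graph. -/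
noncomputable def faceCount (E : OrientedEmbedding G) : ℕ :=
  Nat.card E.Face + {v : V | ∀ w, ¬ G.Adj v w}.ncard

/-- The genus `(2 - (v - e + f)) / 2` of an embedding of a finite connected graph. -/
noncomputable def genus (E : OrientedEmbedding G) : ℚ :=
  (2 - ((Nat.card V : ℚ) - (G.edgeSet.ncard : ℚ) + (E.faceCount : ℚ))) / 2

/-- The facial walk of `F` is a simple cycle: it has length at least three and repeats no
vertex. -/
def IsSimpleFace (E : OrientedEmbedding G) (F : E.Face) : Prop :=
  3 ≤ (E.faceDarts F).ncard ∧ Set.InjOn (fun d : G.Dart => d.fst) (E.faceDarts F)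

/-- A polyhedral embedding: every facial walk is a simple cycle, and the intersection of any two
different faces is empty, a single vertex, or a single edge together with its two ends. -/
def IsPolyhedral (E : OrientedEmbedding G) : Prop :=
  (∀ F : E.Face, E.IsSimpleFace F) ∧
  ∀ F F' : E.Face, F ≠ F' →
    (E.faceVerts F ∩ E.faceVerts F' = ∅ ∧ E.faceEdges F ∩ E.faceEdges F' = ∅) ∨
    (∃ v : V, E.faceVerts F ∩ E.faceVerts F' = {v} ∧ E.faceEdges F ∩ E.faceEdges F' = ∅) ∨
    (∃ v w : V, G.Adj v w ∧ E.faceVerts F ∩ E.faceVerts F' = {v, w} ∧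
      E.faceEdges F ∩ E.faceEdges F' = {s(v, w)})

/-- The dual multigraph: its vertices are the faces, and every edge `e` of `G` gives one dual edge
(labelled by `e`) that joins the faces containing the two darts of `e`. -/
def dual (E : OrientedEmbedding G) : Graph E.Face (Sym2 V) where
  vertexSet := Set.univ
  IsLink e F F' := ∃ d : G.Dart, d.edge = e ∧ E.faceOf d = F ∧ E.faceOf d.symm = F'
  isLink_symm := by
    refine fun e _ => ⟨?_⟩
    rintro F F' ⟨d, hd, h, h'⟩
    exact ⟨d.symm, by rw [Dart.edge_symm, hd], h', by rw [Dart.symm_symm, h]⟩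
  eq_or_eq_of_isLink_of_isLink := by
    rintro e F₁ F₂ F₃ F₄ ⟨d, hd, rfl, rfl⟩ ⟨d', hd', rfl, rfl⟩
    rcases (dart_edge_eq_iff d d').1 (hd.trans hd'.symm) with rfl | rfl
    · exact Or.inl rfl
    · exact Or.inr rfl
  left_mem_of_isLink := fun _ _ _ _ => Set.mem_univ _

end OrientedEmbedding

/-- A graph is planar if it has an embedding of genus `0`. -/
def IsPlanar {V : Type u} (G : SimpleGraph V) : Prop :=
  ∃ E : OrientedEmbedding G, E.genus = 0

end SimpleGraph

/-!
Let `E₀` be an embedding of genus `0` and `E` a polyhedral embedding of the connected graph `G`.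
The proof shows that, up to orientation, `E` and `E₀` have the same faces; hence they have the same
genus. A cubic graph embedded with simple dual is polyhedrally embedded, so the second claim is a
case of the first.

The substitute for the Jordan curve theorem is linear algebra in the space of real functions on
darts. Coboundaries `d ↦ p d.fst - p d.snd` of functions on vertices are orthogonal to the functions
`d ↦ c (E.faceOf d) - c (E.faceOf d.symm)` coming from functions on the faces of any embedding `E`
(`sum_coboundary_mul_faceFlow`). For connected graphs the two spaces have dimensions `|V| - 1` and
`|F| - 1` inside the `|E|`-dimensional space of antisymmetric functions, so for genus `0` they fill
it. Therefore the flow along a face `F` of `E` is the flow of some function `c` on the faces of `E₀`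
(`exists_faceFlow_eq`): `c` is a colouring of the faces of `E₀` which changes exactly across the
edges of `F`.

A face `F` of a polyhedral embedding is an induced nonseparating cycle. In the form used here: a
colouring of the darts that is preserved by reversing a dart off `F`, and is constant on the darts
at each vertex off `F`, has a single value on all darts off `F` (`apply_eq_of_not_onBoundary`).
The darts coloured by `c` thus see only one colour off `F`, and since the colour changes across an
edge of `F`, some face of `E₀` consists of darts of the edges of `F` only. As `F` is a simple cycle
and no rotation has a fixed point, that face is `F` or `F` reversed
(`exists_face_eq_or_eq_reverse`).
-/

namespace SimpleGraph

universe u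

variable {V : Type u} {G : SimpleGraph V}

/-! ### Preliminaries on embeddings -/

theorem Connected.forall_of_adj (hc : G.Connected) {P : V → Prop} {u : V} (hu : P u)
    (hP : ∀ v w, G.Adj v w → P v → P w) (v : V) : P v := by
  obtain ⟨p⟩ := hc.preconnected u v
  induction p with
  | nil => exact hu
  | cons h _ ih => exact ih (hP _ _ h hu)

instance finite_dart [Finite V] : Finite G.Dart :=
  Finite.of_injective _ Dart.toProd_injective

theorem sameCycle_induction {α : Type*} [Finite α] {f : Equiv.Perm α} {x y : α}
    (h : f.SameCycle x y) {P : α → Prop} (hx : P x) (hf : ∀ z, P z → P (f z)) : P y := by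
  obtain ⟨n, rfl⟩ := h.exists_nat_pow_eq
  clear h
  induction n with
  | zero => simpa using hx
  | succ n ih => rw [pow_succ']; exact hf _ ih

namespace OrientedEmbedding

variable (E : OrientedEmbedding G)

instance finite_face [Finite V] : Finite E.Face :=
  inferInstanceAs (Finite (Quotient _))

theorem exists_faceOf_eq (F : E.Face) : ∃ d, E.faceOf d = F := Quotient.exists_rep F

theorem faceNext_apply (d : G.Dart) : E.faceNext d = E.nx d.symm := rfl

theorem fst_faceNext (d : G.Dart) : (E.faceNext d).fst = d.snd := E.fst_nx d.symm

theorem faceOf_eq_iff {d d' : G.Dart} :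
    E.faceOf d = E.faceOf d' ↔ E.faceNext.SameCycle d d' := Quotient.eq

theorem faceOf_faceNext (d : G.Dart) : E.faceOf (E.faceNext d) = E.faceOf d :=
  E.faceOf_eq_iff.2 (Equiv.Perm.sameCycle_apply_left.2 (Equiv.Perm.SameCycle.refl _ _))

theorem faceNext_symm (d : G.Dart) : E.faceNext d.symm = E.nx d := by
  rw [faceNext_apply, Dart.symm_symm]

theorem faceOf_nx (d : G.Dart) : E.faceOf (E.nx d) = E.faceOf d.symm := by
  rw [← faceNext_symm, faceOf_faceNext]

theorem face_induction [Finite V] {d d' : G.Dart} (h : E.faceOf d' = E.faceOf d)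
    {P : G.Dart → Prop} (hd : P d) (hP : ∀ z, P z → P (E.faceNext z)) : P d' :=
  sameCycle_induction (E.faceOf_eq_iff.1 h.symm) hd hP

theorem vertex_induction [Finite V] {d d' : G.Dart} (h : d'.fst = d.fst)
    {P : G.Dart → Prop} (hd : P d) (hP : ∀ z, P z → P (E.nx z)) : P d' :=
  sameCycle_induction (E.sameCycle_nx d d' h.symm) hd hP

theorem eq_of_nx_eq_self [Finite V] {d d' : G.Dart} (hd : E.nx d = d) (h : d'.fst = d.fst) :
    d' = d :=
  E.vertex_induction (P := fun z => z = d) h rfl (by rintro z rfl; exact hd)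

/-! ### Flows of face colourings -/

/-- The coboundary of a function on the vertices, as an antisymmetric function on darts. -/
def coboundary (G : SimpleGraph V) : (V → ℝ) →ₗ[ℝ] (G.Dart → ℝ) where
  toFun p d := p d.fst - p d.snd
  map_add' p q := by ext d; simp; ring
  map_smul' a p := by ext d; simp; ring

/-- The flow which sends `c F` units around each face `F`, as an antisymmetric function on
darts: the difference of the values of `c` on the two sides of a dart. -/
def faceFlow : (E.Face → ℝ) →ₗ[ℝ] (G.Dart → ℝ) where
  toFun c d := c (E.faceOf d) - c (E.faceOf d.symm)
  map_add' p q := by ext d; simp; ring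
  map_smul' a p := by ext d; simp; ring

/-- The space of antisymmetric functions on darts. -/
def antisymm (G : SimpleGraph V) : Submodule ℝ (G.Dart → ℝ) where
  carrier := {f | ∀ d, f d.symm = -f d}
  add_mem' hf hg d := by simp [hf d, hg d]; ring
  zero_mem' d := by simp
  smul_mem' a f hf d := by simp [hf d]

theorem coboundary_mem (p : V → ℝ) : coboundary G p ∈ antisymm G := fun d => by
  simp [coboundary]

theorem faceFlow_mem (c : E.Face → ℝ) : E.faceFlow c ∈ antisymm G := fun d => by
  simp [faceFlow]

theorem sum_coboundary_mul_faceFlow [Fintype G.Dart] (p : V → ℝ) (c : E.Face → ℝ) :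
    ∑ d, coboundary G p d * E.faceFlow c d = 0 := by
  -- along each facial walk the coboundary telescopes
  have h1 : ∑ d : G.Dart, p d.snd * c (E.faceOf d) = ∑ d : G.Dart, p d.fst * c (E.faceOf d) := by
    rw [← Equiv.sum_comp E.faceNext (fun d => p d.fst * c (E.faceOf d))]
    simp only [fst_faceNext, faceOf_faceNext]
  have h2 : ∑ d : G.Dart, (p d.fst - p d.snd) * c (E.faceOf d.symm) =
      ∑ d : G.Dart, (p d.snd - p d.fst) * c (E.faceOf d) := by
    rw [← Equiv.sum_comp (Dart.symm_involutive.toPerm Dart.symm)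
      (fun d : G.Dart => (p d.snd - p d.fst) * c (E.faceOf d))]
    rfl
  simp only [coboundary, faceFlow, LinearMap.coe_mk, AddHom.coe_mk, mul_sub,
    Finset.sum_sub_distrib, h2]
  simp only [sub_mul, Finset.sum_sub_distrib, h1]
  ring

theorem finrank_antisymm_le [Finite V] :
    Module.finrank ℝ (antisymm G) ≤ G.edgeSet.ncard := by
  classical
  cases nonempty_fintype V
  -- an antisymmetric function is determined by its values on one dart of each edge
  have hrep : ∀ e : G.edgeSet, ∃ d : G.Dart, d.edge = e := by
    rintro ⟨e, he⟩
    induction e with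
    | _ v w => exact ⟨⟨(v, w), he⟩, rfl⟩
  choose r hr using hrep
  let φ : antisymm G →ₗ[ℝ] (G.edgeSet → ℝ) :=
    (LinearMap.funLeft ℝ ℝ r).comp (antisymm G).subtype
  have hφ : Function.Injective φ := by
    rw [injective_iff_map_eq_zero]
    rintro ⟨f, hf⟩ h0
    ext d
    have h1 : f (r ⟨d.edge, d.edge_mem⟩) = 0 := congrFun h0 ⟨d.edge, d.edge_mem⟩
    rcases (dart_edge_eq_iff _ _).1 (hr ⟨d.edge, d.edge_mem⟩) with h | h <;> rw [h] at h1
    · exact h1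
    · rw [hf] at h1
      simpa using h1
  have h := LinearMap.finrank_le_finrank_of_injective hφ
  rwa [Module.finrank_fintype_fun_eq_card, ← Nat.card_eq_fintype_card, Nat.card_coe_set_eq] at h

theorem card_le_finrank_range_coboundary_add_one [Finite V] (hc : G.Connected) :
    Nat.card V ≤ Module.finrank ℝ (LinearMap.range (coboundary G)) + 1 := by
  cases nonempty_fintype V
  have hk : Module.finrank ℝ (LinearMap.ker (coboundary G)) ≤ 1 := by
    have h1 : (fun _ => 1 : V → ℝ) ∈ LinearMap.ker (coboundary G) := by
      ext d; simp [coboundary]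
    obtain ⟨v⟩ := hc.nonempty
    refine finrank_le_one ⟨_, h1⟩ ?_
    rintro ⟨p, hp⟩
    refine ⟨p v, Subtype.ext (funext fun w => ?_)⟩
    have := hc.forall_of_adj (P := fun w => p v = p w) (u := v) rfl (fun u w h e => by
      have := congrFun hp ⟨(u, w), h⟩
      simp only [coboundary, LinearMap.coe_mk, AddHom.coe_mk, Pi.zero_apply] at this
      linarith) w
    simp [this]
  have := LinearMap.finrank_range_add_finrank_ker (coboundary G)
  rw [Module.finrank_fintype_fun_eq_card, ← Nat.card_eq_fintype_card] at this
  omega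

/-- Only constant colourings have zero flow: the colour is the same across every edge, hence
around every vertex. -/
theorem card_le_finrank_range_faceFlow_add_one [Finite V] (hc : G.Connected) (d₀ : G.Dart) :
    Nat.card E.Face ≤ Module.finrank ℝ (LinearMap.range E.faceFlow) + 1 := by
  classical
  cases nonempty_fintype E.Face
  have hk : Module.finrank ℝ (LinearMap.ker E.faceFlow) ≤ 1 := by
    have h1 : (fun _ => 1 : E.Face → ℝ) ∈ LinearMap.ker E.faceFlow := by
      ext d; simp [faceFlow]
    refine finrank_le_one ⟨_, h1⟩ ?_
    rintro ⟨c, hcol⟩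
    refine ⟨c (E.faceOf d₀), Subtype.ext (funext fun F => ?_)⟩
    have hs : ∀ d, c (E.faceOf d.symm) = c (E.faceOf d) := fun d => by
      have := congrFun hcol d
      simp only [faceFlow, LinearMap.coe_mk, AddHom.coe_mk, Pi.zero_apply] at this
      linarith
    have hv : ∀ d d' : G.Dart, d'.fst = d.fst → c (E.faceOf d') = c (E.faceOf d) := fun d d' h =>
      E.vertex_induction (P := fun z => c (E.faceOf z) = c (E.faceOf d)) h rfl
        (fun z hz => by rw [faceOf_nx, hs, hz])
    obtain ⟨d, rfl⟩ := E.exists_faceOf_eq F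
    have := hc.forall_of_adj
      (P := fun v => ∀ d : G.Dart, d.fst = v → c (E.faceOf d) = c (E.faceOf d₀))
      (u := d₀.fst) (hv d₀) (fun u w h hu d hd => by
        rw [← hu ⟨(u, w), h⟩ rfl, ← hs ⟨(u, w), h⟩]
        exact hv _ _ hd) d.fst d rfl
    simp [this]
  have := LinearMap.finrank_range_add_finrank_ker E.faceFlow
  rw [Module.finrank_fintype_fun_eq_card, ← Nat.card_eq_fintype_card] at this
  omega

/-- In an embedding of genus `0` every flow that is a combination of closed walks is the flow of a
colouring of the faces; it is stated here for the combinations of facial walks of another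
embedding. -/
theorem exists_faceFlow_eq [Finite V] (hc : G.Connected) {E₀ : OrientedEmbedding G}
    (h0 : E₀.genus = 0) (c : E.Face → ℝ) : ∃ c₀, E₀.faceFlow c₀ = E.faceFlow c := by
  classical
  cases nonempty_fintype V
  cases isEmpty_or_nonempty G.Dart with
  | inl h => exact ⟨0, funext fun d => (h.false d).elim⟩
  | inr h =>
  obtain ⟨d₀⟩ := h
  have hiso : {v : V | ∀ w, ¬ G.Adj v w} = ∅ := by
    have : Nontrivial V := ⟨_, _, d₀.fst_ne_snd⟩
    refine Set.eq_empty_of_forall_notMem fun v hv => ?_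
    obtain ⟨w, hw⟩ := hc.preconnected.exists_adj_of_nontrivial v
    exact hv w hw
  have heuler : Nat.card V + Nat.card E₀.Face = G.edgeSet.ncard + 2 := by
    have : ((Nat.card V + Nat.card E₀.Face : ℕ) : ℚ) = ((G.edgeSet.ncard + 2 : ℕ) : ℚ) := by
      simp only [genus, faceCount, hiso, Set.ncard_empty, add_zero] at h0
      push_cast
      linarith
    exact_mod_cast this
  have hsq : ∀ p : V → ℝ, ∑ d, coboundary G p d * coboundary G p d = 0 → coboundary G p = 0 :=
    fun p hp => funext fun d => by
      simpa using (Finset.sum_eq_zero_iff_of_nonneg (fun i _ => mul_self_nonneg _)).1 hp d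
        (Finset.mem_univ _)
  have hdisj : LinearMap.range (coboundary G) ⊓ LinearMap.range E₀.faceFlow = ⊥ := by
    rw [eq_bot_iff]
    rintro _ ⟨⟨p, rfl⟩, ⟨b, hb⟩⟩
    refine hsq p ?_
    rw [← E₀.sum_coboundary_mul_faceFlow p b, hb]
  have hle : LinearMap.range (coboundary G) ⊔ LinearMap.range E₀.faceFlow ≤ antisymm G := by
    refine sup_le ?_ ?_
    · rintro _ ⟨p, rfl⟩; exact coboundary_mem p
    · rintro _ ⟨p, rfl⟩; exact E₀.faceFlow_mem p
  have htop := Submodule.eq_of_le_of_finrank_le hle (by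
    have h1 := Submodule.finrank_sup_add_finrank_inf_eq
      (LinearMap.range (coboundary G)) (LinearMap.range E₀.faceFlow)
    rw [hdisj, finrank_bot] at h1
    have h2 := finrank_antisymm_le (G := G)
    have h3 := card_le_finrank_range_coboundary_add_one hc
    have h4 := E₀.card_le_finrank_range_faceFlow_add_one hc d₀
    omega)
  have hmem := E.faceFlow_mem c
  rw [← htop, Submodule.mem_sup] at hmem
  obtain ⟨_, ⟨p, rfl⟩, _, ⟨c₀, rfl⟩, hsum⟩ := hmem
  -- the coboundary part is orthogonal to both flows, hence to itself
  have hp : coboundary G p = 0 := hsq p (by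
    have h1 := E.sum_coboundary_mul_faceFlow p c
    rw [← hsum] at h1
    simpa only [Pi.add_apply, mul_add, Finset.sum_add_distrib,
      sum_coboundary_mul_faceFlow, add_zero] using h1)
  exact ⟨c₀, by rw [← hsum, hp, zero_add]⟩

/-! ### Faces of polyhedral embeddings -/

/-- The edge of the dart `d` lies on the boundary of the face `F`. -/
def OnBoundary (F : E.Face) (d : G.Dart) : Prop := E.faceOf d = F ∨ E.faceOf d.symm = F

variable {E}

theorem OnBoundary.symm {F : E.Face} {d : G.Dart} (h : E.OnBoundary F d) :
    E.OnBoundary F d.symm := by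
  rw [OnBoundary, Dart.symm_symm]
  exact Or.symm h

theorem onBoundary_symm {F : E.Face} {d : G.Dart} : E.OnBoundary F d.symm ↔ E.OnBoundary F d :=
  ⟨fun h => by simpa using h.symm, fun h => h.symm⟩

theorem OnBoundary.edge_mem {F : E.Face} {d : G.Dart} (h : E.OnBoundary F d) :
    d.edge ∈ E.faceEdges F := by
  rcases h with h | h
  · exact ⟨d, h, rfl⟩
  · exact ⟨d.symm, h, d.edge_symm⟩

theorem OnBoundary.fst_mem {F : E.Face} {d : G.Dart} (h : E.OnBoundary F d) :
    d.fst ∈ E.faceVerts F := by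
  rcases h with h | h
  · exact ⟨d, h, rfl⟩
  · exact ⟨_, (E.faceOf_faceNext _).trans h, E.fst_faceNext _⟩

theorem IsPolyhedral.eq_of_fst_eq (hE : E.IsPolyhedral) {d d' : G.Dart}
    (hF : E.faceOf d = E.faceOf d') (h : d.fst = d'.fst) : d = d' :=
  (hE.1 (E.faceOf d')).2 hF rfl h

theorem IsPolyhedral.faceOf_symm_ne [Finite V] (hE : E.IsPolyhedral) (d : G.Dart) :
    E.faceOf d.symm ≠ E.faceOf d := by
  intro h
  have h1 : E.faceNext d = d.symm :=
    hE.eq_of_fst_eq ((E.faceOf_faceNext d).trans h.symm) (E.fst_faceNext d)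
  have h2 : E.faceNext d.symm = d :=
    hE.eq_of_fst_eq ((E.faceOf_faceNext _).trans h) (E.fst_faceNext _)
  have h3 : E.faceDarts (E.faceOf d) ⊆ {d, d.symm} := fun d' hd' =>
    E.face_induction (P := fun z => z ∈ ({d, d.symm} : Set G.Dart)) hd' (by simp) (by
      rintro z (rfl | rfl)
      · simp [h1]
      · simp [h2])
  have h4 := Set.ncard_le_ncard h3
  have h5 := Set.ncard_pair d.symm_ne.symm
  have h6 := (hE.1 (E.faceOf d)).1
  omega

/-- Two different faces have at most one edge in common. -/
theorem IsPolyhedral.eq_of_onBoundary [Finite V] (hE : E.IsPolyhedral) {F : E.Face}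
    {d d' : G.Dart} (hd : E.OnBoundary F d) (hd' : E.OnBoundary F d')
    (hF : E.faceOf d ≠ F) (h : E.faceOf d = E.faceOf d') : d = d' := by
  have he : d.edge = d'.edge := by
    have h1 : d.edge ∈ E.faceEdges (E.faceOf d) ∩ E.faceEdges F := ⟨⟨d, rfl, rfl⟩, hd.edge_mem⟩
    have h2 : d'.edge ∈ E.faceEdges (E.faceOf d) ∩ E.faceEdges F :=
      ⟨⟨d', h.symm, rfl⟩, hd'.edge_mem⟩
    rcases hE.2 _ _ hF with ⟨-, h0⟩ | ⟨_, -, h0⟩ | ⟨_, _, -, -, h0⟩ <;> rw [h0] at h1 h2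
    · exact h1.elim
    · exact h1.elim
    · exact h1.trans h2.symm
  rcases (dart_edge_eq_iff _ _).1 he with h1 | rfl
  · exact h1
  · exact absurd h (hE.faceOf_symm_ne d')

/-- The part of the boundary of a face off `F` is a path: it leaves `F` at most once. -/
theorem IsPolyhedral.eq_of_not_onBoundary [Finite V] (hE : E.IsPolyhedral) {F : E.Face}
    {d d' : G.Dart} (h : E.faceOf d = E.faceOf d') (hd : ¬ E.OnBoundary F d)
    (hd' : ¬ E.OnBoundary F d') (hv : d.fst ∈ E.faceVerts F) (hv' : d'.fst ∈ E.faceVerts F) :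
    d = d' := by
  refine hE.eq_of_fst_eq h ?_
  have hF : E.faceOf d ≠ F := fun h => hd (Or.inl h)
  have h1 : d.fst ∈ E.faceVerts (E.faceOf d) ∩ E.faceVerts F := ⟨⟨d, rfl, rfl⟩, hv⟩
  have h2 : d'.fst ∈ E.faceVerts (E.faceOf d) ∩ E.faceVerts F := ⟨⟨d', h.symm, rfl⟩, hv'⟩
  rcases hE.2 _ _ hF with ⟨h0, -⟩ | ⟨_, h0, -⟩ | ⟨v, w, -, h0, h3⟩
  · rw [h0] at h1; exact h1.elim
  · rw [h0] at h1 h2; exact h1.trans h2.symm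
  · rw [h0] at h1 h2
    have h4 : s(v, w) ∈ E.faceEdges (E.faceOf d) ∩ E.faceEdges F := by rw [h3]; rfl
    obtain ⟨⟨e, heF, he⟩, ⟨e', heF', he'⟩⟩ := h4
    have heb : E.OnBoundary F e := by
      rcases (dart_edge_eq_iff e e').1 (he.trans he'.symm) with rfl | rfl
      · exact Or.inl heF'
      · exact Or.inr (by rw [Dart.symm_symm]; exact heF')
    -- `d` and `d'` do not start where the common edge `e` starts, so they start where `e` ends
    have hne : d.fst ≠ e.fst := fun h5 => hd (hE.eq_of_fst_eq heF.symm h5 ▸ heb)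
    have hne' : d'.fst ≠ e.fst := fun h5 =>
      hd' (hE.eq_of_fst_eq (h.symm.trans heF.symm) h5 ▸ heb)
    rcases (dart_edge_eq_mk'_iff' (d := e)).1 he with ⟨h6, -⟩ | ⟨h6, -⟩ <;>
    rcases h1 with h1 | h1 <;> rcases h2 with h2 | h2 <;> simp_all

/-- A face of a polyhedral embedding is an induced nonseparating cycle: a colouring of the darts
which passes freely through the edges and vertices off `F` has one value off `F`. -/
theorem IsPolyhedral.apply_eq_of_not_onBoundary [Finite V] (hc : G.Connected)
    (hE : E.IsPolyhedral) {F : E.Face} {α : Type*} (col : G.Dart → α)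
    (hs : ∀ d, ¬ E.OnBoundary F d → col d.symm = col d)
    (hv : ∀ d d' : G.Dart, d.fst ∉ E.faceVerts F → d.fst = d'.fst → col d = col d')
    {d d' : G.Dart} (hd : ¬ E.OnBoundary F d) (hd' : ¬ E.OnBoundary F d') : col d = col d' := by
  -- the colour is constant along every other face
  have hface : ∀ x y : G.Dart, ¬ E.OnBoundary F x → ¬ E.OnBoundary F y →
      E.faceOf x = E.faceOf y → col x = col y := by
    intro x y hx hy hxy
    -- a starting point of the walk around the face
    obtain ⟨s, hsF, hsu⟩ : ∃ s, E.faceOf s = E.faceOf y ∧ ∀ z, E.faceOf z = E.faceOf y →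
        ¬ E.OnBoundary F z → z.fst ∈ E.faceVerts F → z = s := by
      by_cases h : ∃ s, E.faceOf s = E.faceOf y ∧ ¬ E.OnBoundary F s ∧ s.fst ∈ E.faceVerts F
      · obtain ⟨s, h1, h2, h3⟩ := h
        exact ⟨s, h1, fun z h4 h5 h6 => hE.eq_of_not_onBoundary (h4.trans h1.symm) h5 h2 h6 h3⟩
      · exact ⟨y, rfl, fun z h4 h5 h6 => (h ⟨z, h4, h5, h6⟩).elim⟩
    have key : ∀ z, E.faceOf z = E.faceOf y → ¬ E.OnBoundary F z → col z = col s := by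
      intro z hz
      refine (E.face_induction (P := fun z => E.faceOf z = E.faceOf y ∧
        (¬ E.OnBoundary F z → col z = col s)) (hz.trans hsF.symm) ⟨hsF, fun _ => rfl⟩ ?_).2
      rintro z ⟨hz, ih⟩
      have hz' := (E.faceOf_faceNext z).trans hz
      refine ⟨hz', fun hb => ?_⟩
      by_cases hC : (E.faceNext z).fst ∈ E.faceVerts F
      · rw [hsu _ hz' hb hC]
      · have hzb : ¬ E.OnBoundary F z := fun h => hC (by
          rw [fst_faceNext]
          exact h.symm.fst_mem)
        rw [← ih hzb, ← hs z hzb]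
        exact hv _ _ hC (E.fst_faceNext z)
    rw [key x hxy hx, key y rfl hy]
  -- the colour is constant on the darts off `F` at each vertex of `F`: in the rotation they
  -- follow one another without interruption
  have hvert : ∀ z x : G.Dart, E.faceOf z = F → x.fst = z.fst → ¬ E.OnBoundary F x →
      col x = col (E.nx z) := by
    intro z x hz hx
    refine E.vertex_induction (P := fun x => x.fst = z.fst ∧
      (¬ E.OnBoundary F x → col x = col (E.nx z))) (hx.trans (E.fst_nx z).symm)
      ⟨E.fst_nx z, fun _ => rfl⟩ ?_ |>.2
    rintro y ⟨hy, ih⟩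
    refine ⟨(E.fst_nx y).trans hy, fun hb => ?_⟩
    by_cases hyb : E.OnBoundary F y
    · rcases hyb with hyF | hyF
      · rw [hE.eq_of_fst_eq (hyF.trans hz.symm) hy]
      · exact (hb (Or.inl ((E.faceOf_nx y).trans hyF))).elim
    · rw [← ih hyb, ← hs y hyb]
      refine hface _ _ hb ?_ (E.faceOf_nx y)
      rwa [onBoundary_symm]
  -- consecutive vertices of `F` lie on a common second face
  have hnext : ∀ z : G.Dart, E.faceOf z = F → col (E.nx (E.faceNext z)) = col (E.nx z) := by
    intro z hz
    have hzs : E.faceOf z.symm ≠ F := hz ▸ hE.faceOf_symm_ne z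
    have hzb : E.OnBoundary F z.symm := Or.inr (by rwa [Dart.symm_symm])
    have h1 : ¬ E.OnBoundary F (E.nx z) := fun h => by
      have h2 := hE.eq_of_onBoundary hzb h hzs (E.faceOf_nx z).symm
      have h3 : z.snd = z.fst := (congrArg (fun d : G.Dart => d.fst) h2).trans (E.fst_nx z)
      exact z.snd_ne_fst h3
    obtain ⟨r, hr⟩ := E.faceNext.surjective z.symm
    have hrF : E.faceOf r = E.faceOf z.symm := by rw [← hr, faceOf_faceNext]
    have hrs : r.snd = z.snd := by
      rw [← E.fst_faceNext r, hr]
      rfl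
    have h2 : ¬ E.OnBoundary F r := fun h => by
      have h2 := hE.eq_of_onBoundary hzb h hzs hrF.symm
      have h3 : r.fst = r.snd := by
        rw [hrs, ← h2]
        rfl
      exact r.fst_ne_snd h3
    have h3 : ¬ E.OnBoundary F r.symm := by rwa [onBoundary_symm]
    rw [← hvert (E.faceNext z) r.symm ((E.faceOf_faceNext z).trans hz)
      (hrs.trans (E.fst_faceNext z).symm) h3, hs r h2]
    exact hface _ _ h2 h1 (hrF.trans (E.faceOf_nx z).symm)
  obtain ⟨z₀, rfl⟩ := E.exists_faceOf_eq F
  have hF : ∀ z, E.faceOf z = E.faceOf z₀ → col (E.nx z) = col (E.nx z₀) := fun z hz =>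
    (E.face_induction (P := fun z => E.faceOf z = E.faceOf z₀ ∧ col (E.nx z) = col (E.nx z₀)) hz
      ⟨rfl, rfl⟩ (fun z h => ⟨(E.faceOf_faceNext z).trans h.1, (hnext z h.1).trans h.2⟩)).2
  have hon : ∀ x : G.Dart, x.fst ∈ E.faceVerts (E.faceOf z₀) → ¬ E.OnBoundary (E.faceOf z₀) x →
      col x = col (E.nx z₀) := by
    rintro x ⟨z, hz, hzx⟩ hx
    rw [hvert z x hz hzx.symm hx, hF z hz]
  have hall : ∀ v, ∀ x : G.Dart, x.fst = v → ¬ E.OnBoundary (E.faceOf z₀) x →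
      col x = col (E.nx z₀) := by
    refine hc.forall_of_adj (u := z₀.fst) ?_ ?_
    · exact fun x hx hxb => hon x ⟨z₀, rfl, hx.symm⟩ hxb
    · intro v w hvw ih x hx hxb
      by_cases hw : x.fst ∈ E.faceVerts (E.faceOf z₀)
      · exact hon x hw hxb
      · let e : G.Dart := ⟨(v, w), hvw⟩
        have heb : ¬ E.OnBoundary (E.faceOf z₀) e := fun h => hw (by
          rw [hx]
          exact h.symm.fst_mem)
        rw [← ih e rfl heb, ← hs e heb]
        exact hv _ _ hw hx
  rw [hall _ d rfl hd, hall _ d' rfl hd']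

/-! ### Comparison with a planar embedding -/

/-- If a face `H` of another embedding uses only edges of `F`, then it is `F` or its reverse. -/
theorem IsPolyhedral.eq_or_eq_reverse [Finite V] (hE : E.IsPolyhedral) (E₀ : OrientedEmbedding G)
    {F : E.Face} {H : E₀.Face} (hH : ∀ d, E₀.faceOf d = H → E.OnBoundary F d) :
    (∀ d, E₀.faceOf d = H ↔ E.faceOf d = F) ∨ (∀ d, E₀.faceOf d = H ↔ E.faceOf d.symm = F) := by
  have hnx : ∀ z : G.Dart, E₀.faceNext z ≠ z.symm := fun z hz => by
    have h1 : E.nx z.symm = z.symm := E₀.eq_of_nx_eq_self hz (E.fst_nx _)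
    apply hE.faceOf_symm_ne z
    rw [← h1, ← faceNext_apply, faceOf_faceNext]
  have hfst : ∀ z : G.Dart, (E₀.faceNext z).fst = z.symm.fst := fun z => E₀.fst_faceNext z
  obtain ⟨d₀, rfl⟩ := E₀.exists_faceOf_eq H
  rcases hH d₀ rfl with h0 | h0
  · left
    have hstep : ∀ z, E₀.faceOf z = E₀.faceOf d₀ → E.faceOf z = F →
        E₀.faceNext z = E.faceNext z := by
      intro z hz hzF
      rcases hH _ ((E₀.faceOf_faceNext z).trans hz) with h | h
      · refine hE.eq_of_fst_eq (h.trans ?_) ?_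
        · rw [faceOf_faceNext, hzF]
        · rw [fst_faceNext, fst_faceNext]
      · -- `F` would enter the vertex `z.snd` twice
        have h1 : E.faceNext (E₀.faceNext z).symm = E.faceNext z := by
          refine hE.eq_of_fst_eq ?_ ?_
          · rw [faceOf_faceNext, faceOf_faceNext, h, hzF]
          · rw [fst_faceNext, fst_faceNext]
            exact hfst z
        exact absurd (Dart.symm_involutive.eq_iff.1 (E.faceNext.injective h1)) (hnx z)
    refine fun d => ⟨fun hd => ?_, fun hd => ?_⟩
    · exact (E₀.face_induction (P := fun z => E₀.faceOf z = E₀.faceOf d₀ ∧ E.faceOf z = F) hd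
        ⟨rfl, h0⟩ fun z hz => ⟨(E₀.faceOf_faceNext z).trans hz.1, by
          rw [hstep z hz.1 hz.2, faceOf_faceNext, hz.2]⟩).2
    · exact (E.face_induction (P := fun z => E₀.faceOf z = E₀.faceOf d₀ ∧ E.faceOf z = F)
        (hd.trans h0.symm) ⟨rfl, h0⟩ fun z hz => by
          rw [← hstep z hz.1 hz.2, faceOf_faceNext]
          exact ⟨hz.1, by rw [hstep z hz.1 hz.2, faceOf_faceNext, hz.2]⟩).1
  · right
    have hstep : ∀ z, E₀.faceOf z = E₀.faceOf d₀ → E.faceOf z.symm = F →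
        E.faceNext (E₀.faceNext z).symm = z.symm ∧ E.faceOf (E₀.faceNext z).symm = F := by
      intro z hz hzF
      rcases hH _ ((E₀.faceOf_faceNext z).trans hz) with h | h
      · exact absurd (hE.eq_of_fst_eq (h.trans hzF.symm) (hfst z)) (hnx z)
      · refine ⟨hE.eq_of_fst_eq ?_ ?_, h⟩
        · rw [faceOf_faceNext, h, hzF]
        · rw [fst_faceNext]
          exact hfst z
    refine fun d => ⟨fun hd => ?_, fun hd => ?_⟩
    · exact (E₀.face_induction (P := fun z => E₀.faceOf z = E₀.faceOf d₀ ∧ E.faceOf z.symm = F) hd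
        ⟨rfl, h0⟩ fun z hz => ⟨(E₀.faceOf_faceNext z).trans hz.1, (hstep z hz.1 hz.2).2⟩).2
    · -- `E` traverses the face in the opposite direction
      have hcyc : E.faceNext⁻¹.SameCycle d₀.symm d.symm :=
        Equiv.Perm.sameCycle_inv.2 (E.faceOf_eq_iff.1 (h0.trans hd.symm))
      have := (sameCycle_induction hcyc
        (P := fun z => E₀.faceOf z.symm = E₀.faceOf d₀ ∧ E.faceOf z = F) ⟨by simp, h0⟩
        fun z hz => by
          have h1 := hstep z.symm hz.1 (by simpa using hz.2)
          rw [Dart.symm_symm] at h1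
          rw [Equiv.Perm.inv_eq_iff_eq.2 h1.1.symm, Dart.symm_symm, faceOf_faceNext]
          exact ⟨hz.1, h1.2⟩).1
      simpa using this

/-- Every face of a polyhedral embedding is, up to orientation, a face of any embedding of
genus `0`. -/
theorem IsPolyhedral.exists_face_eq_or_eq_reverse [Finite V] (hc : G.Connected)
    (hE : E.IsPolyhedral) {E₀ : OrientedEmbedding G} (h0 : E₀.genus = 0) (F : E.Face) :
    ∃ H : E₀.Face, (∀ d, E₀.faceOf d = H ↔ E.faceOf d = F) ∨
      (∀ d, E₀.faceOf d = H ↔ E.faceOf d.symm = F) := by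
  classical
  obtain ⟨c, hcol⟩ := E.exists_faceFlow_eq hc h0 (Pi.single F 1)
  have hflow : ∀ d, c (E₀.faceOf d) - c (E₀.faceOf d.symm) =
      (Pi.single F 1 : E.Face → ℝ) (E.faceOf d) - (Pi.single F 1 : E.Face → ℝ) (E.faceOf d.symm) :=
    fun d => congrFun hcol d
  have hs : ∀ d, ¬ E.OnBoundary F d → c (E₀.faceOf d.symm) = c (E₀.faceOf d) := by
    intro d hd
    have h1 := hflow d
    rw [Pi.single_eq_of_ne (fun h => hd (Or.inl h)),
      Pi.single_eq_of_ne (fun h => hd (Or.inr h))] at h1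
    linarith
  have hv : ∀ d d' : G.Dart, d.fst ∉ E.faceVerts F → d.fst = d'.fst →
      c (E₀.faceOf d) = c (E₀.faceOf d') := by
    intro d d' hd hdd'
    refine (E₀.vertex_induction (P := fun z => z.fst = d'.fst ∧
      c (E₀.faceOf z) = c (E₀.faceOf d')) hdd' ⟨rfl, rfl⟩ ?_).2
    rintro z ⟨hz, hzc⟩
    refine ⟨(E₀.fst_nx z).trans hz, ?_⟩
    rw [faceOf_nx, hs z (fun h => hd ?_), hzc]
    rw [hdd', ← hz]
    exact h.fst_mem
  obtain ⟨d, rfl⟩ := E.exists_faceOf_eq F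
  have hne : c (E₀.faceOf d) ≠ c (E₀.faceOf d.symm) := fun h => by
    have h1 := hflow d
    rw [Pi.single_eq_same, Pi.single_eq_of_ne (hE.faceOf_symm_ne d), h] at h1
    norm_num at h1
  -- one side of `d` does not have the colour seen off the face
  obtain ⟨x, hx⟩ : ∃ x, ∀ y, E₀.faceOf y = E₀.faceOf x → E.OnBoundary (E.faceOf d) y := by
    by_contra! hcon
    obtain ⟨y, hy, hyb⟩ := hcon d
    obtain ⟨y', hy', hyb'⟩ := hcon d.symm
    apply hne
    rw [← hy, ← hy']
    exact hE.apply_eq_of_not_onBoundary hc (fun d => c (E₀.faceOf d)) hs hv hyb hyb'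
  exact ⟨E₀.faceOf x, hE.eq_or_eq_reverse E₀ hx⟩

theorem IsPolyhedral.card_face_eq [Finite V] (hc : G.Connected) (hE : E.IsPolyhedral)
    {E₀ : OrientedEmbedding G} (h0 : E₀.genus = 0) : Nat.card E.Face = Nat.card E₀.Face := by
  choose φ hφ using hE.exists_face_eq_or_eq_reverse hc h0
  have hb : ∀ F d, E₀.faceOf d = φ F → E.OnBoundary F d := fun F d h =>
    (hφ F).imp (fun h' => (h' d).1 h) (fun h' => (h' d).1 h)
  have hinj : Function.Injective φ := by
    intro F F' hFF'
    by_contra hne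
    -- two consecutive edges of the common image lie on both faces
    obtain ⟨d, hd⟩ := E₀.exists_faceOf_eq (φ F)
    have hd' := (E₀.faceOf_faceNext d).trans hd
    rcases hφ F with h | h
    · have h1 := (h _).1 hd
      have h2 := (h _).1 hd'
      have h3 := hE.eq_of_onBoundary (hb F' _ (hd.trans hFF')) (hb F' _ (hd'.trans hFF'))
        (h1 ▸ hne) (h1.trans h2.symm)
      exact d.fst_ne_snd ((congrArg (fun d : G.Dart => d.fst) h3).trans (E₀.fst_faceNext d))
    · have h1 := (h _).1 hd
      have h2 := (h _).1 hd'
      have h3 := hE.eq_of_onBoundary (hb F' _ (hd.trans hFF')).symm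
        (hb F' _ (hd'.trans hFF')).symm (h1 ▸ hne) (h1.trans h2.symm)
      have h4 := Dart.symm_involutive.injective h3
      exact d.fst_ne_snd ((congrArg (fun d : G.Dart => d.fst) h4).trans (E₀.fst_faceNext d))
  refine Nat.card_congr (Equiv.ofBijective φ ⟨hinj, fun H => ?_⟩)
  obtain ⟨d, rfl⟩ := E₀.exists_faceOf_eq H
  rcases hφ (E.faceOf d) with h | h
  · exact ⟨_, ((h d).2 rfl).symm⟩
  rcases hφ (E.faceOf d.symm) with h' | h'
  · -- otherwise both faces at the edge of `d` would be sent to the face of `d.symm`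
    have h1 := (h d.symm).2 (by rw [Dart.symm_symm])
    have h2 := (h' d.symm).2 rfl
    exact absurd (hinj (h2.symm.trans h1)) (hE.faceOf_symm_ne d)
  · exact ⟨_, ((h' d).2 rfl).symm⟩

theorem IsPolyhedral.genus_eq_zero [Finite V] (hc : G.Connected) (hE : E.IsPolyhedral)
    (hG : G.IsPlanar) : E.genus = 0 := by
  obtain ⟨E₀, h0⟩ := hG
  rw [← h0]
  simp only [genus, faceCount, hE.card_face_eq hc h0]

/-! ### Cubic graphs -/

theorem faceOf_symm_ne_of_simple (hE : E.dual.Simple) (d : G.Dart) :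
    E.faceOf d.symm ≠ E.faceOf d := fun h =>
  hE.not_isLoopAt d.edge (E.faceOf d) ⟨d, rfl, rfl, h⟩

theorem edge_eq_of_simple (hE : E.dual.Simple) {d d' : G.Dart} (h : E.faceOf d = E.faceOf d')
    (hs : E.faceOf d.symm = E.faceOf d'.symm) : d.edge = d'.edge :=
  hE.eq_of_isLink ⟨d, rfl, rfl, rfl⟩ ⟨d', rfl, h.symm, hs.symm⟩

/-- At a vertex of degree three any two darts are consecutive in the rotation. -/
theorem eq_or_eq_nx_or_eq_nx [Finite V] [G.LocallyFinite] (h3 : G.IsRegularOfDegree 3)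
    {d d' : G.Dart} (h : d'.fst = d.fst) : d' = d ∨ d' = E.nx d ∨ d = E.nx d' := by
  classical
  cases nonempty_fintype V
  by_contra! hcon
  obtain ⟨h1, h2, h4⟩ := hcon
  have h5 : E.nx d ≠ d := fun h5 => h1 (E.eq_of_nx_eq_self h5 h)
  have h6 : E.nx d' ≠ d' := fun h6 => h1 (E.eq_of_nx_eq_self h6 h.symm).symm
  have h7 : E.nx d' ≠ E.nx d := fun h7 => h1 (E.nx.injective h7)
  have hcard : ({d, E.nx d, d', E.nx d'} : Finset G.Dart).card = 4 := by
    rw [Finset.card_insert_of_notMem, Finset.card_insert_of_notMem, Finset.card_pair h6.symm]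
    · simp [h2.symm, h7.symm]
    · simp [h5.symm, Ne.symm h1, h4]
  have hdeg : (Finset.univ.filter fun x : G.Dart => x.fst = d.fst).card = 3 := by
    rw [G.dart_fst_fiber_card_eq_degree, ← h3 d.fst]
    congr!
  have hle : ({d, E.nx d, d', E.nx d'} : Finset G.Dart).card ≤
      (Finset.univ.filter fun x : G.Dart => x.fst = d.fst).card := by
    refine Finset.card_le_card fun x hx => ?_
    simp only [Finset.mem_insert, Finset.mem_singleton] at hx
    rcases hx with rfl | rfl | rfl | rfl <;> simp [fst_nx, h]
  omega

/-- Any two faces through a vertex of a cubic graph share an edge at that vertex. -/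
theorem exists_common_dart [Finite V] [G.LocallyFinite] (h3 : G.IsRegularOfDegree 3)
    {F F' : E.Face} (hF : F ≠ F') {v : V} (hv : v ∈ E.faceVerts F ∩ E.faceVerts F') :
    ∃ d : G.Dart, E.faceOf d = F ∧ E.faceOf d.symm = F' ∧ v ∈ d.edge := by
  obtain ⟨⟨d, rfl, rfl⟩, ⟨d', rfl, hd'⟩⟩ := hv
  rcases eq_or_eq_nx_or_eq_nx (E := E) h3 hd' with rfl | rfl | rfl
  · exact absurd rfl hF
  · exact ⟨d, rfl, (E.faceOf_nx d).symm, Sym2.mem_mk_left _ _⟩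
  · refine ⟨d'.symm, (E.faceOf_nx d').symm, by rw [Dart.symm_symm], ?_⟩
    rw [Dart.edge_symm]
    exact Sym2.mem_iff.2 (Or.inl (E.fst_nx d'))

theorem isPolyhedral_of_simple_dual [Finite V] [G.LocallyFinite] (h3 : G.IsRegularOfDegree 3)
    (hE : E.dual.Simple) : E.IsPolyhedral := by
  refine ⟨fun F => ⟨?_, ?_⟩, fun F F' hF => ?_⟩
  · obtain ⟨d, rfl⟩ := E.exists_faceOf_eq F
    have hne : ∀ z, z ≠ E.faceNext z := fun z hz =>
      z.fst_ne_snd ((congrArg (fun d : G.Dart => d.fst) hz).trans (E.fst_faceNext z))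
    refine (Set.two_lt_ncard (Set.toFinite _)).2 ⟨d, rfl, E.faceNext d, E.faceOf_faceNext d,
      E.faceNext (E.faceNext d), ?_, hne _, fun h => ?_, hne _⟩
    · exact (E.faceOf_faceNext _).trans (E.faceOf_faceNext d)
    · have h1 : E.faceNext d = d.symm := by
        refine Dart.ext _ _ (Prod.ext (E.fst_faceNext d) ?_)
        exact (E.fst_faceNext (E.faceNext d)).symm.trans
          (congrArg (fun d : G.Dart => d.fst) h.symm)
      exact faceOf_symm_ne_of_simple hE d (h1 ▸ E.faceOf_faceNext d)
  · rintro d rfl d' hd' h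
    rcases eq_or_eq_nx_or_eq_nx (E := E) h3 h.symm with h1 | h1 | h1
    · exact h1.symm
    · rw [h1] at hd'
      exact absurd ((E.faceOf_nx d).symm.trans hd') (faceOf_symm_ne_of_simple hE d)
    · rw [h1] at hd'
      exact absurd ((E.faceOf_nx d').symm.trans hd'.symm) (faceOf_symm_ne_of_simple hE d')
  · have hedge : ∀ e ∈ E.faceEdges F ∩ E.faceEdges F',
        ∃ d : G.Dart, d.edge = e ∧ E.faceOf d = F ∧ E.faceOf d.symm = F' := by
      rintro _ ⟨⟨d, rfl, rfl⟩, ⟨d', rfl, h⟩⟩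
      rcases (dart_edge_eq_iff _ _).1 h with rfl | rfl
      · exact absurd rfl hF
      · exact ⟨d, rfl, rfl, rfl⟩
    have hmem : ∀ d : G.Dart, E.faceOf d = F → E.faceOf d.symm = F' →
        d.fst ∈ E.faceVerts F ∩ E.faceVerts F' ∧ d.snd ∈ E.faceVerts F ∩ E.faceVerts F' := by
      intro d h h'
      have h1 : E.OnBoundary F d := Or.inl h
      have h2 : E.OnBoundary F' d := Or.inr h'
      exact ⟨⟨h1.fst_mem, h2.fst_mem⟩, ⟨h1.symm.fst_mem, h2.symm.fst_mem⟩⟩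
    rcases (E.faceVerts F ∩ E.faceVerts F').eq_empty_or_nonempty with h0 | ⟨v, hv⟩
    · refine Or.inl ⟨h0, Set.eq_empty_of_forall_notMem fun e he => ?_⟩
      obtain ⟨d, -, h1, h2⟩ := hedge e he
      exact Set.notMem_empty _ (h0 ▸ (hmem d h1 h2).1)
    · obtain ⟨d, h1, h2, -⟩ := exists_common_dart h3 hF hv
      have huniq : ∀ x : G.Dart, E.faceOf x = F → E.faceOf x.symm = F' → x.edge = d.edge :=
        fun x hx hx' => edge_eq_of_simple hE (hx.trans h1.symm) (hx'.trans h2.symm)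
      refine Or.inr (Or.inr ⟨d.fst, d.snd, d.adj, Set.Subset.antisymm ?_ ?_,
        Set.Subset.antisymm ?_ ?_⟩)
      · intro u hu
        obtain ⟨x, hx, hx', hux⟩ := exists_common_dart h3 hF hu
        rw [huniq x hx hx'] at hux
        exact Sym2.mem_iff.1 hux
      · rintro u (rfl | rfl)
        · exact (hmem d h1 h2).1
        · exact (hmem d h1 h2).2
      · intro e he
        obtain ⟨x, rfl, hx, hx'⟩ := hedge e he
        exact huniq x hx hx'
      · rintro e rfl
        exact ⟨⟨d, h1, rfl⟩, ⟨d.symm, h2, d.edge_symm⟩⟩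

end OrientedEmbedding

end SimpleGraph

theorem mainTheorem2 :
    (∀ {V : Type*} [Finite V] (G : SimpleGraph V), G.Connected → G.IsPlanar →
      ∀ E : G.OrientedEmbedding, E.genus ≠ 0 → ¬ E.IsPolyhedral) ∧
    (∀ {V : Type*} [Finite V] (G : SimpleGraph V) [G.LocallyFinite],
      G.Connected → G.IsPlanar → G.IsRegularOfDegree 3 →
      ∀ E : G.OrientedEmbedding, E.genus ≠ 0 → ¬ E.dual.Simple) := by
  refine ⟨fun G hc hG E hg hE => hg (hE.genus_eq_zero hc hG), fun G _ hc hG h3 E hg hE => hg ?_⟩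
  exact (SimpleGraph.OrientedEmbedding.isPolyhedral_of_simple_dual h3 hE).genus_eq_zero hc hG
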